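/- Let $\mathsf A$ be an abelian category, let $Q=(Q_0,Q_1)$ be a quiver with $Q_0\neq\emptyset$, and let $\mathsf X$ be a full additive subcategory of $\mathsf A$ closed under isomorphisms. **Conventions.** Put $\mathsf X^\perp=\{M : \mathrm{Ext}^1_{\mathsf A}(X,M)=0 \text{ for all } X\in\mathsf X\}$ and ${}^\perp\mathsf X=\{M : \mathrm{Ext}^1_{\mathsf A}(M,X)=0\text{ for all }X\in\mathsf X\}$. A pair $(\mathsf U,\mathsf V)$ of classes of objects of an abelian category is a *cotorsion pair* if $\mathsf U^\perp=\mathsf V$ and ${}^\perp\mathsf V=\mathsf U$; it is *complete* if for every object $M$ there are an epimorphism $U\to M$ with $U\in\mathsf U$ and kernel in $\mathsf U^\perp$, and a monomorphism $M\to V$ with $V\in\mathsf V$ and cokernel in ${}^\perp\mathsf V$. Let $\mathrm{Rep}(Q,\mathsf A)$ be the abelian category of $\mathsf A$-valued representations of $Q$, and let $\mathrm{Rep}(Q,\mathsf X)$ be the class of representations $R$ with $R(i)\in\mathsf X$ for all $i\in Q_0$. For $R\in\mathrm{Rep}(Q,\mathsf A)$ and $i\in Q_0$, the arrows with target $i$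 (respectively, source $i$) induce the canonical morphisms $$\varphi_i^R:\bigoplus_{a:\,j\to i}R(j)\to R(i),\qquad \psi_i^R:R(i)\to\prod_{a:\,i\to j}R(j)$$ whenever these coproducts (respectively, products) exist. Let $\Phi(\mathsf X)$ be the class of all $R$ such that for every $i\in Q_0$ the morphism $\varphi_i^R$ is a monomorphism with cokernel in $\mathsf X$, and let $\Psi(\mathsf X)$ be the class of all $R$ such that for every $i\in Q_0$ the morphism $\psi_i^R$ is an epimorphism with kernel in $\mathsf X$. Define sets of vertices by transfinite recursion: $V_0=\emptyset$; $V_{\alpha+1}$ is the set of vertices $i$ such that every arrow with target $i$ has its source in $\bigcup_{\beta\le\alpha}V_\beta$; and $V_\alpha=\bigcup_{\beta<\alpha}V_\beta$ for a limit ordinal $\alpha$. The quiver $Q$ is *left rooted* if $V_\lambda=Q_0$ for some ordinal $\lambda$, and *right rooted* if the opposite quiver $Q^{\mathrm{op}}$ is left rooted. The category $\mathsf A$ satisfies AB4 if it has all small coproducts and they are exact, and AB4* if it has all small products and they are exact. **Statement.** (a) Suppose that $\mathsf A$ satisfies AB4 and $Q$ is left rooted. Then $(\mathsf X,\mathsf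 X^\perp)$ is a complete cotorsion pair in $\mathsf A$ if and only if $(\Phi(\mathsf X),\mathrm{Rep}(Q,\mathsf X^\perp))$ is a complete cotorsion pair in $\mathrm{Rep}(Q,\mathsf A)$ and $\mathsf X$ is closed under extensions and small coproducts. (b) Suppose that $\mathsf A$ satisfies AB4* and $Q$ is right rooted. Then $({}^\perp\mathsf X,\mathsf X)$ is a complete cotorsion pair in $\mathsf A$ if and only if $(\mathrm{Rep}(Q,{}^\perp\mathsf X),\Psi(\mathsf X))$ is a complete cotorsion pair in $\mathrm{Rep}(Q,\mathsf A)$ and $\mathsf X$ is closed under extensions and small products. -/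

import Mathlib

open CategoryTheory CategoryTheory.Limits

universe w v u

/-! ### Cotorsion pairs in an abelian category -/

section Cotorsion

variable {C : Type u} [Category.{v} C] [Abelian C]

/-- `Ext¹(X, Y) = 0`. The groups `Ext` are Mathlib's (morphisms `X ⟶ Y⟦1⟧` in the derived
category), taken in the universe where they always exist. -/
def ExtOneVanishes (X Y : C) : Prop :=
  haveI : HasExt.{max u v} C := HasExt.standard C
  Subsingleton (Abelian.Ext.{max u v} X Y 1)

/-- `P^⊥`: the objects `M` with `Ext¹(X, M) = 0` for all `X` in `P`. -/
def rightPerp (P : ObjectProperty C) : ObjectProperty C :=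
  fun M => ∀ X : C, P X → ExtOneVanishes X M

/-- `^⊥P`: the objects `M` with `Ext¹(M, X) = 0` for all `X` in `P`. -/
def leftPerp (P : ObjectProperty C) : ObjectProperty C :=
  fun M => ∀ X : C, P X → ExtOneVanishes M X

/-- `f : X ⟶ M` is a special `P`-precover of `M`. -/
structure IsSpecialPrecover (P : ObjectProperty C) {X M : C} (f : X ⟶ M) : Prop where
  epi : Epi f
  mem : P X
  kernel_mem : rightPerp P (kernel f)

/-- `g : M ⟶ Y` is a special `P`-preenvelope of `M`. -/
structure IsSpecialPreenvelope (P : ObjectProperty C) {M Y : C} (g : M ⟶ Y) : Prop where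
  mono : Mono g
  mem : P Y
  cokernel_mem : leftPerp P (cokernel g)

/-- `(P, R)` is a cotorsion pair. -/
structure IsCotorsionPair (P R : ObjectProperty C) : Prop where
  rightPerp_eq : rightPerp P = R
  leftPerp_eq : leftPerp R = P

/-- `(P, R)` is a complete cotorsion pair: every object has a special `P`-precover and a special
`R`-preenvelope. -/
structure IsCompleteCotorsionPair (P R : ObjectProperty C) : Prop extends
    IsCotorsionPair P R where
  exists_precover : ∀ M : C, ∃ (X : C) (f : X ⟶ M), IsSpecialPrecover P f
  exists_preenvelope : ∀ M : C, ∃ (Y : C) (g : M ⟶ Y), IsSpecialPreenvelope R g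

end Cotorsion

/-! ### Rooted quivers -/

section Rooted

/-- The transfinite sequence of sets of vertices with `V₀ = ∅`,
`V_{β+1} = {i | every arrow with target i has its source in ⋃_{γ ≤ β} V_γ}`, and
`V_α = ⋃_{β < α} V_β` for limit ordinals `α` (see the three lemmas below). -/
def rootedSeq (V : Type u) [Quiver.{v} V] (α : Ordinal.{u}) : Set V :=
  {i | (∃ β, ∃ _ : α = Order.succ β, ∀ (j : V), (j ⟶ i) → ∃ γ, ∃ _ : γ ≤ β, j ∈ rootedSeq V γ) ∨
    (Order.IsSuccLimit α ∧ ∃ β, ∃ _ : β < α, i ∈ rootedSeq V β)}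
termination_by α
decreasing_by
  · subst_vars
    exact Order.lt_succ_of_le ‹_›
  · assumption

variable (V : Type u) [Quiver.{v} V]

theorem rootedSeq_zero : rootedSeq V 0 = ∅ := by
  ext i
  rw [rootedSeq]
  simp only [Set.mem_ofPred_eq, Set.mem_empty_iff_false, iff_false, not_or]
  refine ⟨?_, ?_⟩
  · rintro ⟨β, h, -⟩
    exact (Order.bot_lt_succ β).ne h
  · rintro ⟨-, β, h, -⟩
    exact not_lt_bot h

theorem rootedSeq_succ (β : Ordinal.{u}) :
    rootedSeq V (Order.succ β) = {i | ∀ (j : V), (j ⟶ i) → j ∈ ⋃ γ ≤ β, rootedSeq V γ} := by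
  ext i
  rw [rootedSeq]
  simp only [Set.mem_ofPred_eq, Set.mem_iUnion]
  refine ⟨?_, fun h => Or.inl ⟨β, rfl, h⟩⟩
  rintro (⟨β', h, h'⟩ | ⟨h, -⟩)
  · obtain rfl := Order.succ_injective h
    exact h'
  · exact absurd h (Order.not_isSuccLimit_succ β)

theorem rootedSeq_limit {α : Ordinal.{u}} (hα : Order.IsSuccLimit α) :
    rootedSeq V α = ⋃ β < α, rootedSeq V β := by
  ext i
  rw [rootedSeq]
  simp only [Set.mem_ofPred_eq, Set.mem_iUnion]
  refine ⟨?_, fun h => Or.inr ⟨hα, h⟩⟩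
  rintro (⟨β', rfl, -⟩ | ⟨-, h⟩)
  · exact absurd hα (Order.not_isSuccLimit_succ β')
  · exact h

/-- A quiver is left rooted if `V_α` consists of all the vertices for some ordinal `α`. -/
def IsLeftRooted : Prop := ∃ α : Ordinal.{u}, rootedSeq V α = Set.univ

/-- A quiver is right rooted if the opposite quiver is left rooted. -/
def IsRightRooted : Prop := IsLeftRooted Vᵒᵖ

end Rooted

/-! ### Representations of a quiver -/

section Representations

/-- The category of `A`-valued representations of the quiver `V`, as functors on the free (path)
category of `V`; such a functor is the same as a choice of objects for the vertices and of
morphisms for the arrows. -/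
abbrev QuiverRep (V : Type w) [Quiver.{w} V] (A : Type u) [Category.{v} A] :=
  Paths V ⥤ A

variable {V : Type w} [Quiver.{w} V] {A : Type u} [Category.{v} A]

namespace QuiverRep

/-- The object of `A` at the vertex `i`. -/
abbrev vertexObj (X : QuiverRep V A) (i : V) : A := X.obj ((Paths.of V).obj i)

/-- The morphism of `A` attached to the arrow `a`. -/
abbrev arrow (X : QuiverRep V A) {i j : V} (a : i ⟶ j) : X.vertexObj i ⟶ X.vertexObj j :=
  X.map ((Paths.of V).map a)

/-- The canonical morphism `φᵢ : ⨁_{a : j ⟶ i} X(j) ⟶ X(i)`, over all arrows with target `i`. -/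
noncomputable def phi [HasCoproducts.{w} A] (X : QuiverRep V A) (i : V) :
    (∐ fun a : (Σ j : V, (j ⟶ i)) => X.vertexObj a.1) ⟶ X.vertexObj i :=
  Sigma.desc fun a => X.arrow a.2

/-- The canonical morphism `ψᵢ : X(i) ⟶ ∏_{a : i ⟶ j} X(j)`, over all arrows with source `i`. -/
noncomputable def psi [HasProducts.{w} A] (X : QuiverRep V A) (i : V) :
    X.vertexObj i ⟶ ∏ᶜ fun a : (Σ j : V, (i ⟶ j)) => X.vertexObj a.1 :=
  Pi.lift fun a => X.arrow a.2

end QuiverRep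

variable (V)

/-- `Rep(Q, P)`: the representations with values in `P`. -/
def repIn (P : ObjectProperty A) : ObjectProperty (QuiverRep V A) :=
  fun X => ∀ i : V, P (X.vertexObj i)

variable [Abelian A]

/-- `Φ(P)`: for every vertex `i`, `φᵢ` is a monomorphism with cokernel in `P`. -/
def Phi [HasCoproducts.{w} A] (P : ObjectProperty A) : ObjectProperty (QuiverRep V A) :=
  fun X => ∀ i : V, Mono (X.phi i) ∧ P (cokernel (X.phi i))

/-- `Ψ(P)`: for every vertex `i`, `ψᵢ` is an epimorphism with kernel in `P`. -/
def Psi [HasProducts.{w} A] (P : ObjectProperty A) : ObjectProperty (QuiverRep V A) :=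
  fun X => ∀ i : V, Epi (X.psi i) ∧ P (kernel (X.psi i))

end Representations

/-!
A cotorsion pair `(P, R)` is complete if and only if every morphism factors as a monomorphism with
cokernel in `P` followed by an epimorphism with kernel in `R` (Hovey's correspondence), and
`Ext¹`-orthogonality is a lifting property between these two classes. In a left rooted quiver the
relation "there is an arrow `j ⟶ i`" is well founded, so as in Reedy model structures lifts and
factorizations of morphisms of representations are built one vertex at a time, the condition on a
morphism `M ⟶ F` at the vertex `i` bearing on the relative latching map
`F(j) ⨿_{M(j)} M(i) ⟶ F(i)`, where `F(j)` and `M(j)` stand for the sources of `φᵢ`. For `M = 0`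
this map is `φᵢ`, whence `Φ(P)` as left class. Conversely, at a vertex without incoming arrows,
evaluation sends `Φ(P)` to `P`, so that factorizations of constant representations give back those
of `A`. The second equivalence is the first one for `Rep(Qᵒᵖ, Aᵒᵖ) ≃ Rep(Q, A)ᵒᵖ`.
-/

open Opposite

open scoped ZeroObject

section ExtOne

variable {C : Type u} [Category.{v} C] [Abelian C]

open Pretriangulated DerivedCategory

section

variable [HasDerivedCategory.{w} C]

theorem shortExact_of_distinguished {S : ShortComplex C}
    {δ : (singleFunctor C 0).obj S.X₃ ⟶ ((singleFunctor C 0).obj S.X₁)⟦(1 : ℤ)⟧}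
    (hT : Triangle.mk ((singleFunctor C 0).map S.f) ((singleFunctor C 0).map S.g) δ ∈
      distTriang (DerivedCategory C)) : S.ShortExact := by
  have hS : (S.map (singleFunctor C 0 ⋙ homologyFunctor C 0)).ShortExact :=
    { exact := HomologySequence.exact₂ _ hT 0
      mono_f := (HomologySequence.mono_homologyMap_mor₁_iff _ hT (-1) 0).2
        ((isZero_of_isGE ((singleFunctor C 0).obj S.X₃) 0 (-1) (by simp)).eq_of_src _ _)
      epi_g := (HomologySequence.epi_homologyMap_mor₂_iff _ hT 0 1).2
        ((isZero_of_isLE ((singleFunctor C 0).obj S.X₁) 0 1 (by simp)).eq_of_tgt _ _) }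
  exact ShortComplex.shortExact_of_iso (S.mapNatIso (singleFunctorCompHomologyFunctorIso C 0)) hS

theorem exists_shortExact_comp_eq_zero {X Y : C}
    (α : (singleFunctor C 0).obj X ⟶ ((singleFunctor C 0).obj Y)⟦(1 : ℤ)⟧) :
    ∃ (E : C) (i : Y ⟶ E) (p : E ⟶ X) (w : i ≫ p = 0),
      (ShortComplex.mk i p w).ShortExact ∧ (singleFunctor C 0).map p ≫ α = 0 := by
  obtain ⟨Z, f, g, hT⟩ := distinguished_cocone_triangle₂ α
  have : Z.IsGE 0 := TStructure.t.isGE₂ _ hT 0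
    (inferInstanceAs (((singleFunctor C 0).obj Y).IsGE 0))
    (inferInstanceAs (((singleFunctor C 0).obj X).IsGE 0))
  have : Z.IsLE 0 := TStructure.t.isLE₂ _ hT 0
    (inferInstanceAs (((singleFunctor C 0).obj Y).IsLE 0))
    (inferInstanceAs (((singleFunctor C 0).obj X).IsLE 0))
  obtain ⟨E, ⟨e⟩⟩ := exists_iso_singleFunctor_obj_of_isGE_of_isLE Z 0
  obtain ⟨i, hi⟩ := (singleFunctor C 0).map_surjective (f ≫ e.hom)
  obtain ⟨p, hp⟩ := (singleFunctor C 0).map_surjective (e.inv ≫ g)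
  have hT' : Triangle.mk ((singleFunctor C 0).map i) ((singleFunctor C 0).map p) α ∈
      distTriang (DerivedCategory C) :=
    isomorphic_distinguished _ hT _ <| Triangle.isoMk _ _ (Iso.refl _) e.symm (Iso.refl _)
      (show (singleFunctor C 0).map i ≫ e.inv = 𝟙 _ ≫ f by simp [hi])
      (show (singleFunctor C 0).map p ≫ 𝟙 _ = e.inv ≫ g by simp [hp])
      (show α ≫ (𝟙 _)⟦(1 : ℤ)⟧' = 𝟙 _ ≫ α by simp)
  have w : i ≫ p = 0 := (singleFunctor C 0).map_injective <| by
    rw [Functor.map_comp, Functor.map_zero]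
    exact comp_distTriang_mor_zero₁₂ _ hT'
  exact ⟨E, i, p, w, shortExact_of_distinguished (S := .mk i p w) hT',
    comp_distTriang_mor_zero₂₃ _ hT'⟩

end

theorem exists_lift_of_comp_extClass_eq_zero [HasExt.{w} C] {S : ShortComplex C}
    (hS : S.ShortExact) {M : C} (m : M ⟶ S.X₃)
    (h : (Abelian.Ext.mk₀ m).comp hS.extClass (zero_add 1) = 0) : ∃ l : M ⟶ S.X₂, l ≫ S.g = m := by
  obtain ⟨l, hl⟩ := Abelian.Ext.covariant_sequence_exact₃ M hS (Abelian.Ext.mk₀ m) (zero_add 1) h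
  obtain ⟨l, rfl⟩ := (Abelian.Ext.mk₀_bijective _ _).2 l
  exact ⟨l, (Abelian.Ext.mk₀_bijective _ _).1 (by rw [← hl, Abelian.Ext.mk₀_comp_mk₀])⟩

theorem ExtOneVanishes.exists_lift {S : ShortComplex C} (hS : S.ShortExact) {M : C}
    (h : ExtOneVanishes M S.X₁) (m : M ⟶ S.X₃) : ∃ l : M ⟶ S.X₂, l ≫ S.g = m :=
  let : HasExt.{max u v} C := HasExt.standard C
  exists_lift_of_comp_extClass_eq_zero hS m (h.elim _ _)

theorem ExtOneVanishes.exists_extension {S : ShortComplex C} (hS : S.ShortExact) {M : C}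
    (h : ExtOneVanishes S.X₃ M) (m : S.X₁ ⟶ M) : ∃ l : S.X₂ ⟶ M, S.f ≫ l = m := by
  let : HasExt.{max u v} C := HasExt.standard C
  obtain ⟨s, hs⟩ := Abelian.Ext.contravariant_sequence_exact₁ hS M (Abelian.Ext.mk₀ m)
    (add_zero 1) (h.elim _ _)
  obtain ⟨s, rfl⟩ := (Abelian.Ext.mk₀_bijective _ _).2 s
  exact ⟨s, (Abelian.Ext.mk₀_bijective _ _).1 (by rw [← hs, Abelian.Ext.mk₀_comp_mk₀])⟩

theorem extOneVanishes_iff_exists_section {X Y : C} : ExtOneVanishes X Y ↔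
    ∀ ⦃E : C⦄ (i : Y ⟶ E) (p : E ⟶ X) (w : i ≫ p = 0), (ShortComplex.mk i p w).ShortExact →
      ∃ s : X ⟶ E, s ≫ p = 𝟙 X := by
  refine ⟨fun h E i p w hS => h.exists_lift hS (𝟙 X), fun h => ?_⟩
  let : HasExt.{max u v} C := HasExt.standard C
  let := HasDerivedCategory.standard C
  suffices ∀ α : Abelian.Ext.{max u v} X Y 1, α = 0 from
    ⟨fun α β => (this α).trans (this β).symm⟩
  intro α
  obtain ⟨E, i, p, w, hS, hα⟩ := exists_shortExact_comp_eq_zero α.hom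
  obtain ⟨s, hs⟩ := h i p w hS
  apply Abelian.Ext.ext
  calc α.hom = (singleFunctor C 0).map (s ≫ p) ≫ α.hom := by simp [hs]
    _ = (singleFunctor C 0).map s ≫ (singleFunctor C 0).map p ≫ α.hom := by simp
    _ = (0 : Abelian.Ext.{max u v} X Y 1).hom := by rw [hα, comp_zero, Abelian.Ext.zero_hom]

theorem extOneVanishes_iff_exists_retraction {X Y : C} : ExtOneVanishes X Y ↔
    ∀ ⦃E : C⦄ (i : Y ⟶ E) (p : E ⟶ X) (w : i ≫ p = 0), (ShortComplex.mk i p w).ShortExact →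
      ∃ r : E ⟶ Y, i ≫ r = 𝟙 Y := by
  refine ⟨fun h E i p w hS => h.exists_extension hS (𝟙 Y), fun h => ?_⟩
  refine extOneVanishes_iff_exists_section.2 fun E i p w hS => ?_
  obtain ⟨r, hr⟩ := h i p w hS
  exact ⟨_, (ShortComplex.Splitting.ofExactOfRetraction _ hS.exact r hr hS.epi_g).s_g⟩

theorem ExtOneVanishes.hasLiftingProperty {G F E B : C} {i : G ⟶ F} {p : E ⟶ B} [Mono i] [Epi p]
    (h : ExtOneVanishes (cokernel i) (kernel p)) : HasLiftingProperty i p := by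
  let : HasExt.{max u v} C := HasExt.standard C
  have hi : (ShortComplex.mk i (cokernel.π i) (cokernel.condition i)).ShortExact :=
    { exact := ShortComplex.exact_cokernel i }
  have hp : (ShortComplex.mk (kernel.ι p) p (kernel.condition p)).ShortExact :=
    { exact := ShortComplex.exact_kernel p }
  refine ⟨fun {a b} sq => ?_⟩
  -- Pulled back along `i`, the obstruction to lifting `b` vanishes, so it comes from `coker i`.
  have obstruction : (Abelian.Ext.mk₀ b).comp hp.extClass (zero_add 1) = 0 := by
    obtain ⟨c, hc⟩ := Abelian.Ext.contravariant_sequence_exact₂ hi _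
      ((Abelian.Ext.mk₀ b).comp hp.extClass (zero_add 1)) (by
        rw [Abelian.Ext.mk₀_comp_mk₀_assoc, ← sq.w, ← Abelian.Ext.mk₀_comp_mk₀_assoc,
          hp.comp_extClass, Abelian.Ext.comp_zero])
    rw [← hc, h.elim c 0, Abelian.Ext.comp_zero]
  obtain ⟨l, hl : l ≫ p = b⟩ := exists_lift_of_comp_extClass_eq_zero hp b obstruction
  obtain ⟨d, hd⟩ := h.exists_extension hi
    (kernel.lift p (a - i ≫ l) (by simp [hl, sq.w]))
  have hd : i ≫ d ≫ kernel.ι p = a - i ≫ l := by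
    rw [← Category.assoc]
    exact (congrArg (· ≫ kernel.ι p) hd).trans (kernel.lift_ι _ _ _)
  exact ⟨⟨⟨l + d ≫ kernel.ι p, by simp [hd], by simp [hl]⟩⟩⟩

end ExtOne

section Orthogonality

variable {C : Type u} [Category.{v} C] [Abelian C]

theorem ExtOneVanishes.of_retract_left {X X' Y : C} (r : Retract X X')
    (h : ExtOneVanishes X' Y) : ExtOneVanishes X Y := by
  refine extOneVanishes_iff_exists_section.2 fun E i p w hS => ?_
  obtain ⟨l, hl : l ≫ p = r.r⟩ := h.exists_lift hS r.r
  exact ⟨r.i ≫ l, by rw [Category.assoc, hl, r.retract]⟩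

theorem ExtOneVanishes.of_retract_right {X Y Y' : C} (r : Retract Y Y')
    (h : ExtOneVanishes X Y') : ExtOneVanishes X Y := by
  refine extOneVanishes_iff_exists_retraction.2 fun E i p w hS => ?_
  obtain ⟨l, hl : i ≫ l = r.i⟩ := h.exists_extension hS r.i
  exact ⟨l ≫ r.r, by rw [reassoc_of% hl, r.retract]⟩

instance (P : ObjectProperty C) : (leftPerp P).IsClosedUnderIsomorphisms where
  of_iso e h X hX := (h X hX).of_retract_left (.ofIso e.symm)

instance (P : ObjectProperty C) : (rightPerp P).IsClosedUnderIsomorphisms where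
  of_iso e h X hX := (h X hX).of_retract_right (.ofIso e.symm)

instance (R : ObjectProperty C) (J : Type w) :
    (leftPerp R).IsClosedUnderColimitsOfShape (Discrete J) where
  colimitsOfShape_le := by
    rintro X ⟨h⟩ Y hY
    refine extOneVanishes_iff_exists_section.2 fun E i p hw hS => ?_
    choose s hs using fun j => (h.prop_diag_obj j Y hY).exists_lift hS (h.ι.app j)
    refine ⟨h.isColimit.desc ⟨E, Discrete.natTrans s⟩, h.isColimit.hom_ext fun j => ?_⟩
    rw [← Category.assoc, h.isColimit.fac, Category.comp_id]
    exact hs j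

/-- The monomorphisms whose cokernel satisfies `P`: the left class of the factorization system
attached to a cotorsion pair `(P, R)`. -/
def monoWithCokernel (P : ObjectProperty C) : MorphismProperty C :=
  fun _ _ f => Mono f ∧ P (cokernel f)

/-- The epimorphisms whose kernel satisfies `R`: the right class of the factorization system
attached to a cotorsion pair `(P, R)`. -/
def epiWithKernel (R : ObjectProperty C) : MorphismProperty C :=
  fun _ _ f => Epi f ∧ R (kernel f)

theorem monoWithCokernel_iff_of_shortExact (P : ObjectProperty C) [P.IsClosedUnderIsomorphisms]
    {S : ShortComplex C} (hS : S.ShortExact) : monoWithCokernel P S.f ↔ P S.X₃ :=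
  (and_iff_right hS.mono_f).trans <|
    P.prop_iff_of_iso ((cokernelIsCokernel S.f).coconePointUniqueUpToIso hS.gIsCokernel)

theorem epiWithKernel_iff_of_shortExact (R : ObjectProperty C) [R.IsClosedUnderIsomorphisms]
    {S : ShortComplex C} (hS : S.ShortExact) : epiWithKernel R S.g ↔ R S.X₁ :=
  (and_iff_right hS.epi_g).trans <|
    R.prop_iff_of_iso ((kernelIsKernel S.g).conePointUniqueUpToIso hS.fIsKernel)

theorem monoWithCokernel_iff_of_isZero (P : ObjectProperty C) [P.IsClosedUnderIsomorphisms]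
    {Z X : C} (hZ : IsZero Z) (f : Z ⟶ X) : monoWithCokernel P f ↔ P X := by
  obtain rfl : f = 0 := hZ.eq_of_src _ _
  exact (and_iff_right (hZ.mono _)).trans (P.prop_iff_of_iso cokernelZeroIsoTarget)

theorem epiWithKernel_iff_of_isZero (R : ObjectProperty C) [R.IsClosedUnderIsomorphisms]
    {X Z : C} (hZ : IsZero Z) (f : X ⟶ Z) : epiWithKernel R f ↔ R X := by
  obtain rfl : f = 0 := hZ.eq_of_tgt _ _
  exact (and_iff_right (hZ.epi _)).trans (R.prop_iff_of_iso kernelZeroIsoSource)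

instance (P : ObjectProperty C) [P.IsClosedUnderIsomorphisms] :
    (monoWithCokernel P).RespectsIso :=
  MorphismProperty.RespectsIso.of_respects_arrow_iso _ fun _ _ e ⟨hf, hc⟩ =>
    ⟨((MorphismProperty.monomorphisms C).arrow_iso_iff e).1 hf,
      P.prop_of_iso (cokernel.mapIso _ _ (Arrow.leftFunc.mapIso e) (Arrow.rightFunc.mapIso e)
        e.hom.w.symm) hc⟩

instance (R : ObjectProperty C) [R.IsClosedUnderIsomorphisms] :
    (epiWithKernel R).RespectsIso :=
  MorphismProperty.RespectsIso.of_respects_arrow_iso _ fun _ _ e ⟨hf, hk⟩ =>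
    ⟨((MorphismProperty.epimorphisms C).arrow_iso_iff e).1 hf,
      R.prop_of_iso (kernel.mapIso _ _ (Arrow.leftFunc.mapIso e) (Arrow.rightFunc.mapIso e)
        e.hom.w.symm) hk⟩

section

variable (R : ObjectProperty C) [R.IsClosedUnderIsomorphisms]

theorem monoWithCokernel_leftPerp :
    monoWithCokernel (leftPerp R) = MorphismProperty.monomorphisms C ⊓ (epiWithKernel R).llp := by
  ext G F f
  refine ⟨fun ⟨hf, hc⟩ => ⟨hf, fun E B p ⟨hp, hk⟩ => (hc _ hk).hasLiftingProperty⟩,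
    fun ⟨hf, hl⟩ => ⟨hf, fun Y hY => extOneVanishes_iff_exists_section.2 fun E i p w hS => ?_⟩⟩
  have := hl p ((epiWithKernel_iff_of_shortExact R hS).2 hY)
  have sq : CommSq (0 : G ⟶ E) f p (cokernel.π f) := ⟨by simp⟩
  refine ⟨cokernel.desc f sq.lift (by simp), ?_⟩
  rw [← cancel_epi (cokernel.π f)]
  simp

instance : (monoWithCokernel (leftPerp R)).IsStableUnderCobaseChange := by
  rw [monoWithCokernel_leftPerp]; infer_instance

instance : (monoWithCokernel (leftPerp R)).IsStableUnderRetracts := by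
  rw [monoWithCokernel_leftPerp]; infer_instance

instance : (monoWithCokernel (leftPerp R)).IsStableUnderComposition := by
  rw [monoWithCokernel_leftPerp]; infer_instance

instance : (leftPerp R).IsClosedUnderExtensions where
  prop_X₂_of_shortExact {S} hS h₁ h₃ := by
    have h := (monoWithCokernel (leftPerp R)).comp_mem (0 : (0 : C) ⟶ S.X₁) S.f
      ((monoWithCokernel_iff_of_isZero _ (isZero_zero C) _).2 h₁)
      ((monoWithCokernel_iff_of_shortExact _ hS).2 h₃)
    exact (monoWithCokernel_iff_of_isZero _ (isZero_zero C) _).1 h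

end

theorem shortExact_pushout {S : ShortComplex C} (hS : S.ShortExact) {Y : C} (j : S.X₁ ⟶ Y) :
    (ShortComplex.mk (pushout.inr S.f j) (pushout.desc S.g 0 (by simp))
      (pushout.inr_desc _ _ _)).ShortExact := by
  have := hS.mono_f
  have := hS.epi_g
  have epi : Epi (pushout.desc (f := S.f) (g := j) S.g 0 (by simp)) :=
    epi_of_epi_fac (pushout.inl_desc _ _ _)
  refine { exact := ShortComplex.exact_of_g_is_cokernel _ ?_ }
  refine CokernelCofork.IsColimit.ofπ' _ _ fun {T} t ht => ?_
  have ht' : S.f ≫ pushout.inl S.f j ≫ t = 0 := by rw [pushout.condition_assoc, ht, comp_zero]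
  refine ⟨hS.exact.desc _ ht', pushout.hom_ext ?_ ?_⟩
  · rw [pushout.inl_desc_assoc, hS.exact.g_desc]
  · rw [pushout.inr_desc_assoc, zero_comp, ht]

theorem IsCompleteCotorsionPair.hasFactorization {P R : ObjectProperty C}
    (h : IsCompleteCotorsionPair P R) :
    (monoWithCokernel P).HasFactorization (epiWithKernel R) where
  nonempty_mapFactorizationData {G N} f := by
    have : R.IsClosedUnderIsomorphisms := h.rightPerp_eq ▸ inferInstance
    obtain rfl := h.leftPerp_eq
    obtain ⟨X, q, hq⟩ := h.exists_precover N
    have := hq.epi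
    have : Epi (biprod.desc f q) := epi_of_epi_fac (biprod.inr_desc f q)
    obtain ⟨Y, j, hj⟩ := h.exists_preenvelope (kernel (biprod.desc f q))
    have hS : (ShortComplex.mk _ _ (kernel.condition (biprod.desc f q))).ShortExact :=
      { exact := ShortComplex.exact_kernel _ }
    have hinl : monoWithCokernel (leftPerp R) (biprod.inl : G ⟶ G ⊞ X) :=
      (monoWithCokernel_iff_of_shortExact _
        (ShortComplex.Splitting.ofHasBinaryBiproduct G X).shortExact).2 hq.mem
    exact ⟨{
      Z := pushout (kernel.ι (biprod.desc f q)) j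
      i := biprod.inl ≫ pushout.inl _ _
      p := pushout.desc (biprod.desc f q) 0 (by simp)
      fac := by rw [Category.assoc, pushout.inl_desc, biprod.inl_desc]
      hi := (monoWithCokernel _).comp_mem _ _ hinl <|
        (monoWithCokernel _).of_isPushout (IsPushout.of_hasPushout _ j)
          ⟨hj.mono, hj.cokernel_mem⟩
      hp := (epiWithKernel_iff_of_shortExact R (shortExact_pushout hS j)).2 hj.mem }⟩

theorem IsCotorsionPair.isComplete_of_hasFactorization {P R : ObjectProperty C}
    (h : IsCotorsionPair P R) [(monoWithCokernel P).HasFactorization (epiWithKernel R)] :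
    IsCompleteCotorsionPair P R := by
  have : R.IsClosedUnderIsomorphisms := h.rightPerp_eq ▸ inferInstance
  have : P.IsClosedUnderIsomorphisms := h.leftPerp_eq ▸ inferInstance
  refine ⟨h, fun M => ?_, fun M => ?_⟩
  · let d := (monoWithCokernel P).factorizationData (epiWithKernel R) (0 : 0 ⟶ M)
    exact ⟨d.Z, d.p, d.hp.1, (monoWithCokernel_iff_of_isZero P (isZero_zero C) d.i).1 d.hi,
      h.rightPerp_eq ▸ d.hp.2⟩
  · let d := (monoWithCokernel P).factorizationData (epiWithKernel R) (0 : M ⟶ 0)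
    exact ⟨d.Z, d.i, d.hi.1, (epiWithKernel_iff_of_isZero R (isZero_zero C) d.p).1 d.hp,
      h.leftPerp_eq ▸ d.hi.2⟩

theorem isCompleteCotorsionPair_iff_hasFactorization {P R : ObjectProperty C} :
    IsCompleteCotorsionPair P R ↔
      IsCotorsionPair P R ∧ (monoWithCokernel P).HasFactorization (epiWithKernel R) :=
  ⟨fun h => ⟨h.toIsCotorsionPair, h.hasFactorization⟩,
    fun ⟨h, _⟩ => h.isComplete_of_hasFactorization⟩

end Orthogonality

section Adjunction

variable {C D : Type*} [Category* C] [Category* D] [Abelian C] [Abelian D] {L : C ⥤ D} {G : D ⥤ C}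

theorem ExtOneVanishes.leftAdjoint_obj (adj : L ⊣ G) [PreservesFiniteColimits G] {X : C} {M : D}
    (h : ExtOneVanishes X (G.obj M)) : ExtOneVanishes (L.obj X) M := by
  have := adj.isRightAdjoint
  have := adj.rightAdjoint_preservesLimits
  refine extOneVanishes_iff_exists_section.2 fun E i p w hS => ?_
  obtain ⟨(l : X ⟶ G.obj E), hl : l ≫ G.map p = adj.unit.app X⟩ :=
    h.exists_lift (hS.map_of_exact G) _
  refine ⟨(adj.homEquiv _ _).symm l, (adj.homEquiv _ _).injective ?_⟩
  rw [adj.homEquiv_naturality_right, Equiv.apply_symm_apply, adj.homEquiv_id, hl]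

theorem ExtOneVanishes.rightAdjoint_obj (adj : L ⊣ G) [PreservesFiniteLimits L] {X : C} {M : D}
    (h : ExtOneVanishes (L.obj X) M) : ExtOneVanishes X (G.obj M) := by
  have := adj.isLeftAdjoint
  have := adj.leftAdjoint_preservesColimits
  refine extOneVanishes_iff_exists_retraction.2 fun E i p w hS => ?_
  obtain ⟨(l : L.obj E ⟶ M), hl : L.map i ≫ l = adj.counit.app M⟩ :=
    h.exists_extension (hS.map_of_exact L) _
  refine ⟨adj.homEquiv _ _ l, (adj.homEquiv _ _).symm.injective ?_⟩
  rw [adj.homEquiv_naturality_left_symm, Equiv.symm_apply_apply, adj.homEquiv_symm_id, hl]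

end Adjunction

section WellFounded

theorem exists_family_of_wellFounded {ι : Type u} {r : ι → ι → Prop} (wf : WellFounded r)
    {T : ι → Type w} (Q : ∀ i, T i → (∀ j, r j i → T j) → Prop) (h : ∀ i d, ∃ t, Q i t d) :
    ∃ D : ∀ i, T i, ∀ i, Q i (D i) fun j _ => D j := by
  choose t ht using h
  refine ⟨wf.fix t, fun i => ?_⟩
  rw [wf.fix_eq]
  exact ht i _

variable {V : Type u} [Quiver.{v} V]

theorem IsLeftRooted.wellFounded (h : IsLeftRooted V) :
    WellFounded fun j i : V => Nonempty (j ⟶ i) := by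
  have acc (α : Ordinal.{u}) : ∀ i ∈ rootedSeq V α, Acc (fun j i : V => Nonempty (j ⟶ i)) i := by
    induction α using WellFoundedLT.induction with
    | ind α ih =>
      intro i hi
      rw [rootedSeq] at hi
      rcases hi with ⟨β, rfl, hi⟩ | ⟨-, β, hβ, hi⟩
      · refine Acc.intro i fun j ⟨a⟩ => ?_
        obtain ⟨γ, hγ, hj⟩ := hi j a
        exact ih γ (Order.lt_succ_of_le hγ) j hj
      · exact ih β hβ i hi
  obtain ⟨α, hα⟩ := h
  exact ⟨fun i => acc α i (hα ▸ Set.mem_univ i)⟩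

theorem IsLeftRooted.exists_isEmpty_arrows [Nonempty V] (hV : IsLeftRooted V) :
    ∃ i : V, IsEmpty (Σ j : V, (j ⟶ i)) := by
  obtain ⟨i, -, hi⟩ := hV.wellFounded.has_min Set.univ Set.univ_nonempty
  exact ⟨i, ⟨fun a => hi a.1 trivial ⟨a.2⟩⟩⟩

end WellFounded

namespace QuiverRep

variable {V : Type w} [Quiver.{w} V] {A : Type u} [Category.{v} A]

/-- The representation given by objects for the vertices and morphisms for the arrows. -/
def ofArrows (F : V → A) (f : ∀ {i j : V}, (i ⟶ j) → (F i ⟶ F j)) : QuiverRep V A :=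
  Paths.lift { obj := F, map := f }

theorem ofArrows_arrow (F : V → A) (f : ∀ {i j : V}, (i ⟶ j) → (F i ⟶ F j)) {i j : V} (a : i ⟶ j) :
    (ofArrows F f).arrow a = f a :=
  Paths.lift_toPath _ a

/-- The component at the vertex `i` of a morphism of representations. -/
abbrev vertexMap {X Y : QuiverRep V A} (f : X ⟶ Y) (i : V) : X.vertexObj i ⟶ Y.vertexObj i :=
  f.app ((Paths.of V).obj i)

theorem arrow_vertexMap {X Y : QuiverRep V A} (f : X ⟶ Y) {i j : V} (a : i ⟶ j) :
    X.arrow a ≫ vertexMap f j = vertexMap f i ≫ Y.arrow a :=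
  f.naturality _

/-- The morphism of representations given by components compatible with the arrows. -/
def homMk {X Y : QuiverRep V A} (f : ∀ i : V, X.vertexObj i ⟶ Y.vertexObj i)
    (h : ∀ {i j : V} (a : i ⟶ j), X.arrow a ≫ f j = f i ≫ Y.arrow a) : X ⟶ Y :=
  Paths.liftNatTrans f h

theorem hom_ext {X Y : QuiverRep V A} {f g : X ⟶ Y} (h : ∀ i : V, vertexMap f i = vertexMap g i) :
    f = g :=
  NatTrans.ext (funext h)

variable [HasCoproducts.{w} A]

theorem ι_phi (X : QuiverRep V A) {i : V} (a : Σ j : V, (j ⟶ i)) :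
    Sigma.ι (fun a : Σ j : V, (j ⟶ i) => X.vertexObj a.1) a ≫ X.phi i = X.arrow a.2 :=
  Sigma.ι_desc _ _

/-- The morphism `⨁_{a : j ⟶ i} X(j) ⟶ ⨁_{a : j ⟶ i} Y(j)` induced by a morphism `X ⟶ Y`. -/
noncomputable abbrev phiSourceMap {X Y : QuiverRep V A} (f : X ⟶ Y) (i : V) :
    (∐ fun a : Σ j : V, (j ⟶ i) => X.vertexObj a.1) ⟶
      ∐ fun a : Σ j : V, (j ⟶ i) => Y.vertexObj a.1 :=
  Limits.Sigma.map fun a => vertexMap f a.1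

theorem phiSourceMap_phi {X Y : QuiverRep V A} (f : X ⟶ Y) (i : V) :
    phiSourceMap f i ≫ Y.phi i = X.phi i ≫ vertexMap f i :=
  Sigma.hom_ext _ _ fun a => by
    rw [Sigma.ι_map_assoc, ι_phi, reassoc_of% X.ι_phi, arrow_vertexMap]

variable (A) in
/-- The functor `X ↦ ⨁_{a : j ⟶ i} X(j)`. -/
noncomputable def phiSource (i : V) : QuiverRep V A ⥤ A where
  obj X := ∐ fun a : Σ j : V, (j ⟶ i) => X.vertexObj a.1
  map f := phiSourceMap f i

variable (A) in
/-- The morphisms `φᵢ` as a natural transformation. -/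
noncomputable def phiNatTrans (i : V) :
    phiSource A i ⟶ (evaluation (Paths V) A).obj ((Paths.of V).obj i) where
  app X := X.phi i
  naturality _ _ f := phiSourceMap_phi f i

theorem nonempty_evaluationLeftAdjoint_iso_of_isEmpty (i : V)
    [IsEmpty (Σ j : V, (j ⟶ i))] (M : A) :
    Nonempty (vertexObj ((evaluationLeftAdjoint A ((Paths.of V).obj i)).obj M) i ≅ M) := by
  have path (p : Quiver.Path i i) : p = Quiver.Path.nil := by
    cases p with
    | nil => rfl
    | cons p a => exact isEmptyElim (⟨_, a⟩ : Σ j : V, (j ⟶ i))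
  have : Unique ((Paths.of V).obj i ⟶ (Paths.of V).obj i) := ⟨⟨𝟙 _⟩, path⟩
  exact ⟨coproductUniqueIso _⟩

end QuiverRep

namespace QuiverRep

variable {V : Type w} [Quiver.{w} V] {A : Type u} [Category.{v} A] [HasCoproducts.{w} A]
  [HasPushouts A]

/-- The relative latching map `M(i) ⊔ ⨁ F(j) ⟶ F(i)` of `α : M ⟶ F` at the vertex `i`, where the
sums run over the arrows `a : j ⟶ i` and the pushout is taken over `⨁ M(j)`. -/
noncomputable def relativeLatching {M F : QuiverRep V A} (α : M ⟶ F) (i : V) :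
    pushout (M.phi i) (phiSourceMap α i) ⟶ F.vertexObj i :=
  pushout.desc (vertexMap α i) (F.phi i) (phiSourceMap_phi α i).symm

theorem inl_relativeLatching {M F : QuiverRep V A} (α : M ⟶ F) (i : V) :
    pushout.inl _ _ ≫ relativeLatching α i = vertexMap α i :=
  pushout.inl_desc _ _ _

theorem inr_relativeLatching {M F : QuiverRep V A} (α : M ⟶ F) (i : V) :
    pushout.inr _ _ ≫ relativeLatching α i = F.phi i :=
  pushout.inr_desc _ _ _

/-- The morphisms of representations whose relative latching maps belong to `W`. -/
def reedy (W : MorphismProperty A) : MorphismProperty (QuiverRep V A) :=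
  fun _ _ α => ∀ i : V, W (relativeLatching α i)

theorem relativeLatching_iff_phi (W : MorphismProperty A) [W.RespectsIso] {Z F : QuiverRep V A}
    (α : Z ⟶ F) (i : V) [IsIso (Z.phi i)] : W (relativeLatching α i) ↔ W (F.phi i) := by
  rw [← inr_relativeLatching α i, W.cancel_left_of_respectsIso]

theorem exists_vertex_lift {W : MorphismProperty A} {M F E B : QuiverRep V A} {α : M ⟶ F}
    {p : E ⟶ B} {i : V} (hα : W.llp (relativeLatching α i)) (hp : W (vertexMap p i))
    {u : M ⟶ E} {v : F ⟶ B} (sq : CommSq u α p v)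
    (d : ∀ (j : V), (j ⟶ i) → (F.vertexObj j ⟶ E.vertexObj j))
    (hu : ∀ (j : V) (a : j ⟶ i), vertexMap α j ≫ d j a = vertexMap u j)
    (hv : ∀ (j : V) (a : j ⟶ i), d j a ≫ vertexMap p j = vertexMap v j) :
    ∃ l : F.vertexObj i ⟶ E.vertexObj i, vertexMap α i ≫ l = vertexMap u i ∧
      l ≫ vertexMap p i = vertexMap v i ∧
      ∀ (j : V) (a : j ⟶ i), F.arrow a ≫ l = d j a ≫ E.arrow a := by
  have := hα _ hp
  have latching_sq : CommSq (pushout.desc (vertexMap u i)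
      (Sigma.desc fun a : Σ j : V, (j ⟶ i) => d a.1 a.2 ≫ E.arrow a.2) (by
        refine Sigma.hom_ext _ _ fun a => ?_
        rw [Sigma.ι_map_assoc, Sigma.ι_desc, reassoc_of% M.ι_phi, reassoc_of% hu, arrow_vertexMap]))
      (relativeLatching α i) (vertexMap p i) (vertexMap v i) := by
    refine ⟨pushout.hom_ext ?_ (Sigma.hom_ext _ _ fun a => ?_)⟩
    · rw [pushout.inl_desc_assoc, reassoc_of% inl_relativeLatching]
      exact congrArg (fun f => vertexMap f i) sq.w
    · rw [pushout.inr_desc_assoc, reassoc_of% inr_relativeLatching]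
      rw [Sigma.ι_desc_assoc, Category.assoc, arrow_vertexMap, reassoc_of% hv, reassoc_of% F.ι_phi,
        arrow_vertexMap]
  refine ⟨latching_sq.lift, ?_, latching_sq.fac_right, fun j a => ?_⟩
  · rw [← inl_relativeLatching, Category.assoc, latching_sq.fac_left, pushout.inl_desc]
  · rw [← F.ι_phi ⟨j, a⟩, ← inr_relativeLatching α, Category.assoc, Category.assoc,
      latching_sq.fac_left, pushout.inr_desc, Sigma.ι_desc]

theorem reedy_llp_le (hV : IsLeftRooted V) (W : MorphismProperty A) :
    (reedy W.llp : MorphismProperty (QuiverRep V A)) ≤ (W.functorCategory (Paths V)).llp := by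
  refine fun (M F : QuiverRep V A) α hα (E B : QuiverRep V A) p hp => ⟨fun {u v} sq => ?_⟩
  obtain ⟨l, hl⟩ := exists_family_of_wellFounded hV.wellFounded
    (T := fun i => { l : F.vertexObj i ⟶ E.vertexObj i //
      vertexMap α i ≫ l = vertexMap u i ∧ l ≫ vertexMap p i = vertexMap v i })
    (fun i l d => ∀ (j : V) (a : j ⟶ i), F.arrow a ≫ l.1 = (d j ⟨a⟩).1 ≫ E.arrow a)
    (fun i d => by
      obtain ⟨l, hu, hv, hl⟩ := exists_vertex_lift (hα i) (hp _) sq (fun j a => (d j ⟨a⟩).1)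
        (fun j a => (d j ⟨a⟩).2.1) (fun j a => (d j ⟨a⟩).2.2)
      exact ⟨⟨l, hu, hv⟩, hl⟩)
  exact ⟨⟨homMk (fun i => (l i).1) fun a => hl _ _ a, hom_ext fun i => (l i).2.1,
    hom_ext fun i => (l i).2.2⟩⟩

theorem reedy_le_functorCategory (hV : IsLeftRooted V) (W : MorphismProperty A)
    [W.IsStableUnderCoproducts.{w}] [W.IsStableUnderCobaseChange] [W.IsStableUnderComposition] :
    reedy W ≤ W.functorCategory (Paths V) := by
  intro M F α hα (i : V)
  change W (vertexMap α i)
  induction i using hV.wellFounded.induction with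
  | _ i ih =>
    have latching : W (phiSourceMap α i) :=
      MorphismProperty.colimMap _ fun a => ih a.as.1 ⟨a.as.2⟩
    rw [← inl_relativeLatching]
    exact W.comp_mem _ _ (W.of_isPushout (IsPushout.of_hasPushout _ _) latching) (hα i)

section Factorization

variable {W₁ W₂ : MorphismProperty A} [W₁.HasFactorization W₂]

theorem exists_vertex_factorization {M N : QuiverRep V A} (g : M ⟶ N) (i : V)
    (d : ∀ j : V, (j ⟶ i) → MorphismProperty.MapFactorizationData ⊤ W₂ (vertexMap g j)) :
    ∃ (t : MorphismProperty.MapFactorizationData ⊤ W₂ (vertexMap g i))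
      (m : pushout (M.phi i) (Limits.Sigma.map fun a : Σ j : V, (j ⟶ i) => (d a.1 a.2).i) ⟶ t.Z),
      W₁ m ∧ pushout.inl _ _ ≫ m = t.i ∧
      ∀ a : Σ j : V, (j ⟶ i), Sigma.ι (fun a : Σ j : V, (j ⟶ i) => (d a.1 a.2).Z) a ≫
        pushout.inr _ _ ≫ m ≫ t.p = (d a.1 a.2).p ≫ N.arrow a.2 := by
  let q : pushout (M.phi i) (Limits.Sigma.map fun a : Σ j : V, (j ⟶ i) => (d a.1 a.2).i) ⟶
      N.vertexObj i :=
    pushout.desc (vertexMap g i)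
      (Sigma.desc fun a : Σ j : V, (j ⟶ i) => (d a.1 a.2).p ≫ N.arrow a.2) <| by
        refine Sigma.hom_ext _ _ fun a => ?_
        rw [reassoc_of% M.ι_phi, Sigma.ι_map_assoc, Sigma.ι_desc, (d a.1 a.2).fac_assoc,
          arrow_vertexMap]
  let t := W₁.factorizationData W₂ q
  refine ⟨⟨t.Z, pushout.inl _ _ ≫ t.i, t.p, ?_, trivial, t.hp⟩, t.i, t.hi, rfl, fun a => ?_⟩
  · rw [Category.assoc, t.fac, pushout.inl_desc]
  · rw [t.fac, pushout.inr_desc, Sigma.ι_desc]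

theorem hasFactorization_reedy (hV : IsLeftRooted V) :
    (reedy W₁).HasFactorization (W₂.functorCategory (Paths V)) where
  nonempty_mapFactorizationData {M N : QuiverRep V A} g := by
    obtain ⟨D, hD⟩ := exists_family_of_wellFounded hV.wellFounded
      (T := fun i => MorphismProperty.MapFactorizationData ⊤ W₂ (vertexMap g i)) _
      (fun i d => exists_vertex_factorization (W₁ := W₁) g i fun j a => d j ⟨a⟩)
    choose m hm inl_m ι_inr_m_p using hD
    let f {j i : V} (a : j ⟶ i) : (D j).Z ⟶ (D i).Z :=
      Sigma.ι (fun a : Σ j : V, (j ⟶ i) => (D a.1).Z) ⟨j, a⟩ ≫ pushout.inr _ _ ≫ m i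
    have arrow_i {j i : V} (a : j ⟶ i) : M.arrow a ≫ (D i).i = (D j).i ≫ f a := by
      rw [← inl_m i, ← M.ι_phi ⟨j, a⟩, Category.assoc, pushout.condition_assoc,
        Sigma.ι_map_assoc]
    have f_p {j i : V} (a : j ⟶ i) : f a ≫ (D i).p = (D j).p ≫ N.arrow a := by
      simpa only [f, Category.assoc] using ι_inr_m_p i ⟨j, a⟩
    let F : QuiverRep V A := ofArrows (fun i => (D i).Z) f
    have F_arrow {j i : V} (a : j ⟶ i) : F.arrow a = f a := ofArrows_arrow _ _ _
    let α : M ⟶ F := homMk (fun i => (D i).i) fun a => F_arrow a ▸ arrow_i a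
    let β : F ⟶ N := homMk (fun i => (D i).p) fun a => F_arrow a ▸ f_p a
    have latching (i : V) : relativeLatching α i = m i := by
      refine pushout.hom_ext ?_ (Sigma.hom_ext _ _ fun a => ?_)
      · rw [inl_relativeLatching]
        exact (inl_m i).symm
      · rw [inr_relativeLatching, ι_phi]
        exact F_arrow a.2
    exact ⟨⟨F, α, β, hom_ext fun i => (D i).fac, fun i => latching i ▸ hm i, fun i => (D i).hp⟩⟩

end Factorization

end QuiverRep

open QuiverRep

section CotorsionPhi

variable {V : Type w} [Quiver.{w} V] {A : Type u} [Category.{v} A]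

instance (R : ObjectProperty A) [R.IsClosedUnderIsomorphisms] :
    (repIn V R : ObjectProperty (QuiverRep V A)).IsClosedUnderIsomorphisms where
  of_iso e h i := R.prop_of_iso (((evaluation (Paths V) A).obj _).mapIso e) (h i)

variable [Abelian A]

theorem shortExact_vertex {S : ShortComplex (QuiverRep V A)} (hS : S.ShortExact) (i : V) :
    (S.map ((evaluation (Paths V) A).obj ((Paths.of V).obj i))).ShortExact :=
  hS.map_of_exact _

theorem epiWithKernel_repIn (R : ObjectProperty A) [R.IsClosedUnderIsomorphisms] :
    epiWithKernel (repIn V R) = (epiWithKernel R).functorCategory (Paths V) := by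
  ext M N p
  have iff_of_epi [Epi p] (i : V) :
      epiWithKernel R (vertexMap p i) ↔ R (QuiverRep.vertexObj (kernel p) i) :=
    epiWithKernel_iff_of_shortExact R (shortExact_vertex
      (S := .mk (kernel.ι p) p (kernel.condition p)) { exact := ShortComplex.exact_kernel p } i)
  refine ⟨fun ⟨_, hk⟩ i => (iff_of_epi i).2 (hk i), fun h => ?_⟩
  have (i : Paths V) : Epi (p.app i) := (h i).1
  have := NatTrans.epi_of_epi_app p
  exact ⟨this, fun i => (iff_of_epi i).1 (h i)⟩

variable [HasCoproducts.{w} A]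

theorem Phi_of_retract (R : ObjectProperty A) [R.IsClosedUnderIsomorphisms] {X Y : QuiverRep V A}
    (r : Retract X Y) (h : Phi V (leftPerp R) Y) : Phi V (leftPerp R) X := fun i =>
  (monoWithCokernel (leftPerp R)).of_retract (f := X.phi i) (g := Y.phi i)
    (NatTrans.retractArrowApp (phiNatTrans A i) r) (h i)

instance (P : ObjectProperty A) [P.IsClosedUnderIsomorphisms] :
    (Phi V P).IsClosedUnderIsomorphisms where
  of_iso e h i := ((monoWithCokernel P).arrow_mk_iso_iff
    (Arrow.isoMk ((phiSource A i).mapIso e) (((evaluation (Paths V) A).obj _).mapIso e)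
      ((phiNatTrans A i).naturality e.hom))).1 (h i)

theorem reedy_iff_Phi_of_isZero (P : ObjectProperty A) [P.IsClosedUnderIsomorphisms]
    {Z F : QuiverRep V A} (hZ : IsZero Z) (α : Z ⟶ F) :
    reedy (monoWithCokernel P) α ↔ Phi V P F := by
  have isZero_vertexObj (i : V) : IsZero (Z.vertexObj i) :=
    ((evaluation (Paths V) A).obj _).map_isZero hZ
  refine forall_congr' fun i => ?_
  have isZero_source : IsZero (∐ fun a : Σ j : V, (j ⟶ i) => Z.vertexObj a.1) :=
    (IsZero.iff_id_eq_zero _).2 (Sigma.hom_ext _ _ fun _ => (isZero_vertexObj _).eq_of_src _ _)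
  have : IsIso (Z.phi i) :=
    ⟨0, isZero_source.eq_of_src _ _, (isZero_vertexObj i).eq_of_src _ _⟩
  exact relativeLatching_iff_phi _ α i

theorem reedy_monoWithCokernel_le [(MorphismProperty.monomorphisms A).IsStableUnderCoproducts.{w}]
    (hV : IsLeftRooted V) (R : ObjectProperty A) [R.IsClosedUnderIsomorphisms] :
    reedy (monoWithCokernel (leftPerp R)) ≤ monoWithCokernel (leftPerp (repIn V R)) := by
  rw [monoWithCokernel_leftPerp (repIn V R), epiWithKernel_repIn,
    ← MorphismProperty.functorCategory_monomorphisms]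
  have le := (monoWithCokernel_leftPerp R).le
  exact le_inf
    (fun _ _ _ h => reedy_le_functorCategory hV _ _ fun i => (le _ (h i)).1)
    (fun _ _ _ h => reedy_llp_le hV _ _ fun i => (le _ (h i)).2)

theorem hasFactorization_repIn
    [(MorphismProperty.monomorphisms A).IsStableUnderCoproducts.{w}] (hV : IsLeftRooted V)
    (R : ObjectProperty A) [R.IsClosedUnderIsomorphisms]
    [(monoWithCokernel (leftPerp R)).HasFactorization (epiWithKernel R)] :
    (monoWithCokernel (leftPerp (repIn V R))).HasFactorization (epiWithKernel (repIn V R)) where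
  nonempty_mapFactorizationData f := by
    obtain ⟨d⟩ := (hasFactorization_reedy (W₁ := monoWithCokernel (leftPerp R))
      (W₂ := epiWithKernel R) hV).nonempty_mapFactorizationData f
    exact ⟨{ d with
      hi := reedy_monoWithCokernel_le hV R _ d.hi
      hp := (epiWithKernel_repIn R).ge _ d.hp }⟩

theorem Phi_leftPerp_le [(MorphismProperty.monomorphisms A).IsStableUnderCoproducts.{w}]
    (hV : IsLeftRooted V) (R : ObjectProperty A) [R.IsClosedUnderIsomorphisms] :
    Phi V (leftPerp R) ≤ leftPerp (repIn V R) := fun F hF =>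
  (monoWithCokernel_iff_of_isZero _ (isZero_zero _) (0 : 0 ⟶ F)).1 <|
    reedy_monoWithCokernel_le hV R _ ((reedy_iff_Phi_of_isZero _ (isZero_zero _) _).2 hF)

theorem leftPerp_repIn_le_Phi (hV : IsLeftRooted V) (R : ObjectProperty A)
    [R.IsClosedUnderIsomorphisms]
    [(monoWithCokernel (leftPerp R)).HasFactorization (epiWithKernel R)] :
    leftPerp (repIn V R) ≤ Phi V (leftPerp R) := fun M hM => by
  obtain ⟨d⟩ := (hasFactorization_reedy (W₁ := monoWithCokernel (leftPerp R))
    (W₂ := epiWithKernel R) hV).nonempty_mapFactorizationData (0 : 0 ⟶ M)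
  obtain ⟨_, hk⟩ : epiWithKernel (repIn V R) d.p := (epiWithKernel_repIn R).ge _ d.hp
  obtain ⟨s, hs⟩ := (hM _ hk).exists_lift
    (S := .mk (kernel.ι d.p) d.p (kernel.condition d.p))
    { exact := ShortComplex.exact_kernel d.p } (𝟙 M)
  exact Phi_of_retract R ⟨s, d.p, hs⟩ ((reedy_iff_Phi_of_isZero _ (isZero_zero _) _).1 d.hi)

instance [(MorphismProperty.monomorphisms A).IsStableUnderCoproducts.{w}] (i : Paths V) :
    (evaluationLeftAdjoint A i).PreservesMonomorphisms where
  preserves {X Y} f hf := by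
    have (t : Paths V) : Mono (((evaluationLeftAdjoint A i).map f).app t) := by
      have h : Mono (Limits.Sigma.map fun _ : i ⟶ t => f) :=
        MorphismProperty.colimMap (W := MorphismProperty.monomorphisms A) _ fun _ => hf
      have e : ((evaluationLeftAdjoint A i).map f).app t = Limits.Sigma.map fun _ : i ⟶ t => f := by
        refine Sigma.hom_ext _ _ fun a => ?_
        exact (Sigma.ι_desc _ _).trans (Sigma.ι_map (fun _ : i ⟶ t => f) a).symm
      rw [e]
      exact h
    exact NatTrans.mono_of_mono_app _

instance [(MorphismProperty.monomorphisms A).IsStableUnderCoproducts.{w}] (i : Paths V) :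
    PreservesFiniteLimits (evaluationLeftAdjoint A i) := by
  have := (evaluationAdjunctionRight A i).leftAdjoint_preservesColimits
  have := (evaluationAdjunctionRight A i).left_adjoint_additive
  have := Functor.preservesHomology_of_preservesMonos_and_cokernels (evaluationLeftAdjoint A i)
  exact Functor.preservesFiniteLimits_of_preservesHomology _

theorem IsCompleteCotorsionPair.phi [(MorphismProperty.monomorphisms A).IsStableUnderCoproducts.{w}]
    (hV : IsLeftRooted V) {P R : ObjectProperty A} (h : IsCompleteCotorsionPair P R) :
    IsCompleteCotorsionPair (Phi V P) (repIn V R) := by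
  have : R.IsClosedUnderIsomorphisms := h.rightPerp_eq ▸ inferInstance
  have := h.hasFactorization
  obtain rfl := h.leftPerp_eq
  have left : leftPerp (repIn V R) = Phi V (leftPerp R) :=
    le_antisymm (leftPerp_repIn_le_Phi hV R) (Phi_leftPerp_le hV R)
  have right : rightPerp (Phi V (leftPerp R)) = repIn V R := by
    refine le_antisymm (fun M hM i => ?_) fun M hM F hF => left.ge F hF M hM
    rw [← h.rightPerp_eq]
    intro X hX
    let adj := evaluationAdjunctionRight A ((Paths.of V).obj i)
    refine .rightAdjoint_obj adj (hM _ (left.le _ fun N hN => ?_))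
    exact .leftAdjoint_obj adj (hX _ (hN i))
  have : (monoWithCokernel (Phi V (leftPerp R))).HasFactorization (epiWithKernel (repIn V R)) :=
    left ▸ hasFactorization_repIn hV R
  exact IsCotorsionPair.isComplete_of_hasFactorization ⟨right, left⟩

section

variable {P : ObjectProperty A} [P.IsClosedUnderIsomorphisms] {i : V} [IsEmpty (Σ j : V, (j ⟶ i))]

theorem Phi.prop_of_isEmpty {X : QuiverRep V A} (hX : Phi V P X) : P (X.vertexObj i) :=
  (monoWithCokernel_iff_of_isZero P
    ((IsZero.iff_id_eq_zero _).2 (Sigma.hom_ext _ _ fun a => isEmptyElim a)) _).1 (hX i)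

theorem monoWithCokernel_vertexMap_of_isEmpty {X Y : QuiverRep V A} {f : X ⟶ Y}
    (hf : monoWithCokernel (Phi V P) f) : monoWithCokernel P (vertexMap f i) := by
  have := hf.1
  exact (monoWithCokernel_iff_of_shortExact P (shortExact_vertex
    (S := .mk f (cokernel.π f) (cokernel.condition f))
    { exact := ShortComplex.exact_cokernel f } i)).2 hf.2.prop_of_isEmpty

end

theorem IsCompleteCotorsionPair.of_phi {P : ObjectProperty A} [P.IsClosedUnderIsomorphisms]
    (i : V) [IsEmpty (Σ j : V, (j ⟶ i))]
    (h : IsCompleteCotorsionPair (Phi V P) (repIn V (rightPerp P))) :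
    IsCompleteCotorsionPair P (rightPerp P) := by
  have left : leftPerp (rightPerp P) = P := by
    refine le_antisymm (fun M hM => ?_) fun X hX M hM => hM X hX
    have hL := h.leftPerp_eq.le _ fun N hN =>
      .leftAdjoint_obj (evaluationAdjunctionRight A ((Paths.of V).obj i)) (hM _ (hN i))
    obtain ⟨e⟩ := nonempty_evaluationLeftAdjoint_iso_of_isEmpty i M
    exact P.prop_of_iso e hL.prop_of_isEmpty
  have : (monoWithCokernel P).HasFactorization (epiWithKernel (rightPerp P)) := ⟨fun f => by
    obtain ⟨d⟩ := h.hasFactorization.nonempty_mapFactorizationData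
      ((Functor.const (Paths V)).map f)
    exact ⟨{
      Z := d.Z.vertexObj i
      i := vertexMap d.i i
      p := vertexMap d.p i
      fac := congr_app d.fac _
      hi := monoWithCokernel_vertexMap_of_isEmpty d.hi
      hp := (epiWithKernel_repIn _).le _ d.hp i }⟩⟩
  exact IsCotorsionPair.isComplete_of_hasFactorization ⟨rfl, left⟩

theorem isCompleteCotorsionPair_iff_phi [Nonempty V]
    [(MorphismProperty.monomorphisms A).IsStableUnderCoproducts.{w}] (hV : IsLeftRooted V)
    (P : ObjectProperty A) [P.IsClosedUnderIsomorphisms] :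
    IsCompleteCotorsionPair P (rightPerp P) ↔
      IsCompleteCotorsionPair (Phi V P) (repIn V (rightPerp P)) ∧
        P.IsClosedUnderExtensions ∧
          ∀ J : Type w, P.IsClosedUnderColimitsOfShape (Discrete J) := by
  refine ⟨fun h => ⟨h.phi hV, ?_, fun J => ?_⟩, fun h => ?_⟩
  · exact h.leftPerp_eq ▸ inferInstance
  · exact h.leftPerp_eq ▸ inferInstance
  · obtain ⟨i, _⟩ := hV.exists_isEmpty_arrows
    exact h.1.of_phi i

end CotorsionPhi

section Equivalence

variable {C D : Type*} [Category* C] [Category* D] [Abelian C] [Abelian D]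
  (F : C ⥤ D) [F.IsEquivalence]

theorem extOneVanishes_obj_iff {X Y : C} :
    ExtOneVanishes (F.obj X) (F.obj Y) ↔ ExtOneVanishes X Y := by
  let adj := F.asEquivalence.toAdjunction
  let unitIso : Y ≅ F.inv.obj (F.obj Y) := F.asEquivalence.unitIso.app Y
  exact ⟨fun h => (h.rightAdjoint_obj adj).of_retract_right (.ofIso unitIso),
    fun h => .leftAdjoint_obj adj (h.of_retract_right (.ofIso unitIso.symm))⟩

theorem rightPerp_inverseImage (P : ObjectProperty D) [P.IsClosedUnderIsomorphisms] :
    rightPerp (P.inverseImage F) = (rightPerp P).inverseImage F := by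
  ext Y
  refine ⟨fun h M hM => ?_, fun h X hX => (extOneVanishes_obj_iff F).1 (h _ hX)⟩
  let e : M ≅ F.obj (F.objPreimage M) := (F.objObjPreimageIso M).symm
  exact ((extOneVanishes_obj_iff F).2 (h _ (P.prop_of_iso e hM))).of_retract_left (.ofIso e)

theorem leftPerp_inverseImage (R : ObjectProperty D) [R.IsClosedUnderIsomorphisms] :
    leftPerp (R.inverseImage F) = (leftPerp R).inverseImage F := by
  ext X
  refine ⟨fun h M hM => ?_, fun h Y hY => (extOneVanishes_obj_iff F).1 (h _ hY)⟩
  let e : M ≅ F.obj (F.objPreimage M) := (F.objObjPreimageIso M).symm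
  exact ((extOneVanishes_obj_iff F).2 (h _ (R.prop_of_iso e hM))).of_retract_right (.ofIso e)

theorem monoWithCokernel_inverseImage (P : ObjectProperty D) [P.IsClosedUnderIsomorphisms] :
    monoWithCokernel (P.inverseImage F) = (monoWithCokernel P).inverseImage F := by
  ext X Y f
  exact and_congr (F.mono_map_iff_mono f).symm (P.prop_iff_of_iso (PreservesCokernel.iso F f))

theorem epiWithKernel_inverseImage (R : ObjectProperty D) [R.IsClosedUnderIsomorphisms] :
    epiWithKernel (R.inverseImage F) = (epiWithKernel R).inverseImage F := by
  ext X Y f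
  exact and_congr (F.epi_map_iff_epi f).symm (R.prop_iff_of_iso (PreservesKernel.iso F f))

theorem IsCompleteCotorsionPair.inverseImage {P R : ObjectProperty D}
    (h : IsCompleteCotorsionPair P R) :
    IsCompleteCotorsionPair (P.inverseImage F) (R.inverseImage F) := by
  have : P.IsClosedUnderIsomorphisms := h.leftPerp_eq ▸ inferInstance
  have : R.IsClosedUnderIsomorphisms := h.rightPerp_eq ▸ inferInstance
  refine isCompleteCotorsionPair_iff_hasFactorization.2 ⟨⟨?_, ?_⟩, ?_⟩
  · rw [rightPerp_inverseImage, h.rightPerp_eq]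
  · rw [leftPerp_inverseImage, h.leftPerp_eq]
  · have := h.hasFactorization
    rw [monoWithCokernel_inverseImage, epiWithKernel_inverseImage]
    infer_instance

theorem inverseImage_inverseImage_inv {C D : Type*} [Category* C] [Category* D] (F : C ⥤ D)
    [F.IsEquivalence] (P : ObjectProperty D) [P.IsClosedUnderIsomorphisms] :
    (P.inverseImage F).inverseImage F.inv = P := by
  ext M
  exact P.prop_iff_of_iso (F.asEquivalence.counitIso.app M)

theorem isCompleteCotorsionPair_inverseImage_iff (P R : ObjectProperty D)
    [P.IsClosedUnderIsomorphisms] [R.IsClosedUnderIsomorphisms] :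
    IsCompleteCotorsionPair (P.inverseImage F) (R.inverseImage F) ↔
      IsCompleteCotorsionPair P R := by
  refine ⟨fun h => ?_, fun h => h.inverseImage F⟩
  simpa only [inverseImage_inverseImage_inv] using h.inverseImage F.inv

end Equivalence

section Opposite

variable {C : Type*} [Category* C] [Abelian C]

theorem extOneVanishes_op_iff {X Y : C} :
    ExtOneVanishes (op Y) (op X) ↔ ExtOneVanishes X Y := by
  rw [extOneVanishes_iff_exists_section, extOneVanishes_iff_exists_retraction]
  refine ⟨fun h E i p w hS => ?_, fun h E i p w hS => ?_⟩
  · obtain ⟨s, hs⟩ := h p.op i.op (by rw [← op_comp, w, op_zero]) hS.op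
    exact ⟨s.unop, Quiver.Hom.op_inj hs⟩
  · obtain ⟨r, hr⟩ := h p.unop i.unop (by rw [← unop_comp, w, unop_zero]) hS.unop
    exact ⟨r.op, Quiver.Hom.unop_inj hr⟩

theorem rightPerp_op (P : ObjectProperty C) : rightPerp P.op = (leftPerp P).op := by
  ext X
  exact ⟨fun h Y hY => extOneVanishes_op_iff.1 (h (op Y) hY),
    fun h Y hY => extOneVanishes_op_iff.2 (h Y.unop hY)⟩

theorem leftPerp_op (P : ObjectProperty C) : leftPerp P.op = (rightPerp P).op := by
  ext X
  exact ⟨fun h Y hY => extOneVanishes_op_iff.1 (h (op Y) hY),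
    fun h Y hY => extOneVanishes_op_iff.2 (h Y.unop hY)⟩

theorem isCotorsionPair_op_iff {P R : ObjectProperty C} :
    IsCotorsionPair R.op P.op ↔ IsCotorsionPair P R := by
  refine ⟨fun ⟨h₁, h₂⟩ => ⟨?_, ?_⟩, fun ⟨h₁, h₂⟩ => ⟨?_, ?_⟩⟩
  · rwa [leftPerp_op, ObjectProperty.op_injective_iff] at h₂
  · rwa [rightPerp_op, ObjectProperty.op_injective_iff] at h₁
  · rw [rightPerp_op, h₂]
  · rw [leftPerp_op, h₁]

theorem monoWithCokernel_op (P : ObjectProperty C) [P.IsClosedUnderIsomorphisms] :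
    monoWithCokernel P.op = (epiWithKernel P).op := by
  ext X Y f
  exact and_congr (unop_epi_iff f).symm (P.prop_iff_of_iso (cokernelOpUnop f.unop))

theorem epiWithKernel_op (R : ObjectProperty C) [R.IsClosedUnderIsomorphisms] :
    epiWithKernel R.op = (monoWithCokernel R).op := by
  ext X Y f
  exact and_congr (unop_mono_iff f).symm (R.prop_iff_of_iso (kernelOpUnop f.unop))

theorem hasFactorization_op_iff {C : Type*} [Category* C] {W₁ W₂ : MorphismProperty C} :
    W₂.op.HasFactorization W₁.op ↔ W₁.HasFactorization W₂ := by
  refine ⟨fun _ => ⟨fun f => ?_⟩, fun _ => inferInstance⟩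
  exact ⟨(W₂.op.factorizationData W₁.op f.op).unop⟩

theorem isCompleteCotorsionPair_op_iff (P R : ObjectProperty C) :
    IsCompleteCotorsionPair R.op P.op ↔ IsCompleteCotorsionPair P R := by
  rw [isCompleteCotorsionPair_iff_hasFactorization, isCompleteCotorsionPair_iff_hasFactorization,
    isCotorsionPair_op_iff]
  refine and_congr_right fun h => ?_
  have : P.IsClosedUnderIsomorphisms := h.leftPerp_eq ▸ inferInstance
  have : R.IsClosedUnderIsomorphisms := h.rightPerp_eq ▸ inferInstance
  rw [monoWithCokernel_op, epiWithKernel_op, hasFactorization_op_iff]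

theorem isClosedUnderExtensions_op_iff {P : ObjectProperty C} :
    P.op.IsClosedUnderExtensions ↔ P.IsClosedUnderExtensions :=
  ⟨fun _ => ⟨fun hS h₁ h₃ => P.op.prop_X₂_of_shortExact hS.op h₃ h₁⟩,
    fun _ => ⟨fun hS h₁ h₃ => P.prop_X₂_of_shortExact hS.unop h₃ h₁⟩⟩

end Opposite

section OpRep

namespace QuiverRep

variable (V : Type w) [Quiver.{w} V] (A : Type u) [Category.{v} A]

/-- The functor sending a representation to the opposite representation of the opposite quiver. -/
def opFunctor : (QuiverRep V A)ᵒᵖ ⥤ QuiverRep Vᵒᵖ Aᵒᵖ where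
  obj X := ofArrows (fun i => op (X.unop.vertexObj i.unop)) fun a => (X.unop.arrow a.unop).op
  map {X Y} f := homMk (fun i => (vertexMap f.unop i.unop).op) fun {i j} a => by
    rw [ofArrows_arrow, ofArrows_arrow]
    exact congrArg Quiver.Hom.op (arrow_vertexMap f.unop a.unop).symm
  map_id _ := hom_ext fun _ => rfl
  map_comp _ _ := hom_ext fun _ => rfl

variable {V A}

theorem opFunctor_arrow (X : QuiverRep V A) {i j : Vᵒᵖ} (a : i ⟶ j) :
    ((opFunctor V A).obj (op X)).arrow a = (X.arrow a.unop).op :=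
  ofArrows_arrow _ _ a

instance : (opFunctor V A).Faithful where
  map_injective h := Quiver.Hom.unop_inj <| hom_ext fun i =>
    Quiver.Hom.op_inj (congrArg (fun f => vertexMap f (op i)) h)

instance : (opFunctor V A).Full where
  map_surjective {X Y} f := by
    have comm {i j : V} (a : i ⟶ j) : (X.unop.arrow a).op ≫ vertexMap f (op i) =
        vertexMap f (op j) ≫ (Y.unop.arrow a).op := by
      have h := arrow_vertexMap f a.op
      rwa [opFunctor_arrow X.unop, opFunctor_arrow Y.unop] at h
    exact ⟨(homMk (fun i => (vertexMap f (op i)).unop) fun a =>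
      (congrArg Quiver.Hom.unop (comm a)).symm).op, hom_ext fun _ => rfl⟩

instance : (opFunctor V A).EssSurj where
  mem_essImage Y := by
    let X : QuiverRep V A := ofArrows (fun i => unop (Y.vertexObj (op i))) fun a =>
      (Y.arrow a.op).unop
    have arrow_eq {i j : Vᵒᵖ} (a : i ⟶ j) :
        ((opFunctor V A).obj (op X)).arrow a = Y.arrow a :=
      (opFunctor_arrow X a).trans (congrArg Quiver.Hom.op (ofArrows_arrow _ _ a.unop))
    let f : (opFunctor V A).obj (op X) ⟶ Y := homMk (fun i => 𝟙 (Y.vertexObj i)) fun a =>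
      (Category.comp_id _).trans ((arrow_eq a).trans (Category.id_comp _).symm)
    have (i : Paths Vᵒᵖ) : IsIso (f.app i) := inferInstanceAs (IsIso (𝟙 _))
    have : IsIso f := NatIso.isIso_of_isIso_app f
    exact ⟨op X, ⟨asIso f⟩⟩

instance : (opFunctor V A).IsEquivalence where

theorem repIn_inverseImage_opFunctor (P : ObjectProperty A) :
    (repIn Vᵒᵖ P.op).inverseImage (opFunctor V A) = (repIn V P).op := by
  ext X
  exact ⟨fun h i => h (op i), fun h i => h i.unop⟩

/-- The arrows with target `i` in the opposite quiver are the arrows with source `i`. -/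
@[simps]
def opArrowsEquiv (i : Vᵒᵖ) : (Σ j : Vᵒᵖ, (j ⟶ i)) ≃ Σ j : V, (i.unop ⟶ j) where
  toFun a := ⟨a.1.unop, a.2.unop⟩
  invFun a := ⟨op a.1, a.2.op⟩

variable [HasProducts.{w} A]

/-- The comparison of the source of `φᵢ` for the opposite representation with the target
of `ψᵢ`. -/
noncomputable def opFunctorPhiSourceIso (X : QuiverRep V A) (i : Vᵒᵖ) :
    (∐ fun a : Σ j : Vᵒᵖ, (j ⟶ i) => op (X.vertexObj a.1.unop)) ≅
      op (∏ᶜ fun a : Σ j : V, (i.unop ⟶ j) => X.vertexObj a.1) :=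
  Sigma.reindex (opArrowsEquiv i) (fun a => op (X.vertexObj a.1)) ≪≫
    (opProductIsoCoproduct fun a : Σ j : V, (i.unop ⟶ j) => X.vertexObj a.1).symm

theorem ι_opFunctorPhiSourceIso_hom (X : QuiverRep V A) {i : Vᵒᵖ} (a : Σ j : Vᵒᵖ, (j ⟶ i)) :
    Sigma.ι (fun a : Σ j : Vᵒᵖ, (j ⟶ i) => op (X.vertexObj a.1.unop)) a ≫
        (opFunctorPhiSourceIso X i).hom =
      (Pi.π (fun a : Σ j : V, (i.unop ⟶ j) => X.vertexObj a.1) (opArrowsEquiv i a)).op :=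
  (Sigma.ι_reindex_hom_assoc (opArrowsEquiv i) (fun a => op (X.vertexObj a.1)) a _).trans
    ((Iso.comp_inv_eq _).2 (π_comp_opProductIsoCoproduct_hom _ _).symm)

theorem opFunctorPhiSourceIso_hom_psi (X : QuiverRep V A) (i : Vᵒᵖ) :
    (opFunctorPhiSourceIso X i).hom ≫ (X.psi i.unop).op =
      ((opFunctor V A).obj (op X)).phi i := by
  refine Sigma.hom_ext _ _ fun a => ?_
  have π_psi : (Pi.π _ (opArrowsEquiv i a)).op ≫ (X.psi i.unop).op = (X.arrow a.2.unop).op :=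
    congrArg Quiver.Hom.op (Pi.lift_π _ _)
  rw [reassoc_of% ι_opFunctorPhiSourceIso_hom X a]
  exact π_psi.trans ((ι_phi _ a).trans (opFunctor_arrow X a.2)).symm

theorem Phi_inverseImage_opFunctor [Abelian A] (P : ObjectProperty A)
    [P.IsClosedUnderIsomorphisms] :
    (Phi Vᵒᵖ P.op).inverseImage (opFunctor V A) = (Psi V P).op := by
  ext X
  have phi_iff (i : Vᵒᵖ) : monoWithCokernel P.op (((opFunctor V A).obj X).phi i) ↔
      epiWithKernel P (X.unop.psi i.unop) := by
    rw [monoWithCokernel_op]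
    exact (epiWithKernel P).op.arrow_mk_iso_iff
      (Arrow.isoMk (opFunctorPhiSourceIso X.unop i) (Iso.refl _)
        ((opFunctorPhiSourceIso_hom_psi X.unop i).trans (Category.comp_id _).symm))
  exact ⟨fun h i => (phi_iff (op i)).1 (h (op i)), fun h i => (phi_iff i).2 (h i.unop)⟩

end QuiverRep

end OpRep

section CotorsionPsi

variable {V : Type w} [Quiver.{w} V] {A : Type u} [Category.{v} A] [HasProducts.{w} A]

theorem epi_piMap [AB4StarOfSize.{w} A] {J : Type w} {X Y : J → A} (f : ∀ j, X j ⟶ Y j)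
    [∀ j, Epi (f j)] : Epi (Limits.Pi.map f) := by
  let α : Discrete.functor X ⟶ Discrete.functor Y := Discrete.natTrans fun j => f j.as
  have (j : Discrete J) : Epi (α.app j) := inferInstanceAs (Epi (f j.as))
  have := NatTrans.epi_of_epi_app α
  exact inferInstanceAs (Epi (lim.map α))

theorem sigmaMap_op {J : Type w} {X Y : J → A} (f : ∀ j, X j ⟶ Y j) :
    (Limits.Sigma.map fun j => (f j).op) =
      (opProductIsoCoproduct Y).inv ≫ (Limits.Pi.map f).op ≫ (opProductIsoCoproduct X).hom := by
  refine Limits.Sigma.hom_ext _ _ fun j => ?_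
  have map_eq_lift : Limits.Pi.map f = Pi.lift fun j => Pi.π X j ≫ f j :=
    Pi.hom_ext _ _ fun j => by rw [Limits.Pi.map_π, Pi.lift_π]
  rw [map_eq_lift, reassoc_of% opProductIsoCoproduct_inv_comp_lift (fun j => Pi.π X j ≫ f j),
    Sigma.ι_desc_assoc, op_comp, Category.assoc, π_comp_opProductIsoCoproduct_hom,
    Limits.Sigma.ι_map]

instance [AB4StarOfSize.{w} A] :
    (MorphismProperty.monomorphisms Aᵒᵖ).IsStableUnderCoproducts.{w} where
  isStableUnderCoproductsOfShape J := by
    refine MorphismProperty.IsStableUnderCoproductsOfShape.mk _ J fun X Y _ _ f hf => ?_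
    have (j : J) : Epi (f j).unop := (unop_epi_iff _).2 (hf j)
    have := epi_piMap fun j => (f j).unop
    have mono : Mono (Limits.Sigma.map fun j => (f j).unop.op) := by
      rw [sigmaMap_op]
      infer_instance
    exact mono

variable [Abelian A]

theorem isCompleteCotorsionPair_iff_psi [Nonempty V] [AB4StarOfSize.{w} A]
    (hV : IsRightRooted V) (P : ObjectProperty A) [P.IsClosedUnderIsomorphisms] :
    IsCompleteCotorsionPair (leftPerp P) P ↔
      IsCompleteCotorsionPair (repIn V (leftPerp P)) (Psi V P) ∧
        P.IsClosedUnderExtensions ∧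
          ∀ J : Type w, P.IsClosedUnderLimitsOfShape (Discrete J) := by
  have products_iff (J : Type w) : P.op.IsClosedUnderColimitsOfShape (Discrete J) ↔
      P.IsClosedUnderLimitsOfShape (Discrete J) := by
    rw [← P.isClosedUnderLimitsOfShape_op_iff_op]
    exact P.isClosedUnderLimitsOfShape_iff_of_equivalence (Discrete.opposite J)
  have h := isCompleteCotorsionPair_iff_phi hV P.op
  rw [rightPerp_op, isCompleteCotorsionPair_op_iff,
    ← isCompleteCotorsionPair_inverseImage_iff (opFunctor V A),
    Phi_inverseImage_opFunctor, repIn_inverseImage_opFunctor, isCompleteCotorsionPair_op_iff,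
    isClosedUnderExtensions_op_iff] at h
  simpa only [products_iff] using h

end CotorsionPsi

theorem mainTheorem4 {A : Type u} [Category.{v} A] [Abelian A]
    (V : Type w) [Quiver.{w} V] [Nonempty V]
    (X : ObjectProperty A) [X.IsClosedUnderIsomorphisms] [X.IsClosedUnderFiniteCoproducts] :
    (∀ [HasCoproducts.{w} A] [AB4OfSize.{w} A], IsLeftRooted V →
      (IsCompleteCotorsionPair X (rightPerp X) ↔
        IsCompleteCotorsionPair (Phi V X) (repIn V (rightPerp X)) ∧
          X.IsClosedUnderExtensions ∧
          ∀ J : Type w, X.IsClosedUnderColimitsOfShape (Discrete J))) ∧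
    (∀ [HasProducts.{w} A] [AB4StarOfSize.{w} A], IsRightRooted V →
      (IsCompleteCotorsionPair (leftPerp X) X ↔
        IsCompleteCotorsionPair (repIn V (leftPerp X)) (Psi V X) ∧
          X.IsClosedUnderExtensions ∧
          ∀ J : Type w, X.IsClosedUnderLimitsOfShape (Discrete J))) :=
  ⟨fun hV => isCompleteCotorsionPair_iff_phi hV X, fun hV => isCompleteCotorsionPair_iff_psi hV X⟩
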